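/- Let $n,m\ge 0$ and $d\ge 1$ be integers, let $\mathcal S(d)$ be the set of unit vectors of $\mathbb C^d$, let $P_{\rm sym}^n$ be the projector onto the symmetric subspace of $(\mathbb C^d)^{\otimes n}$, let $d[n]=\binom{d+n-1}{n}$ be the dimension of that subspace and $\rho_0^n=P_{\rm sym}^n/d[n]$. A probabilistic $n$-to-$m$ cloning oracle for $\mathcal S(d)$ consists of a success probability $p\in(0,1]$ and of two arbitrary (possibly non-linear) maps $\mathcal R$ and $\rho_\perp$ that take density operators supported on the symmetric subspace of $(\mathbb C^d)^{\otimes n}$ to density operators on $(\mathbb C^d)^{\otimes m}$; on the input $\rho$ it outputs $$\mathcal C(\rho)=p\,\mathcal R(\rho)\otimes|0\rangle\langle 0|+(1-p)\,\rho_\perp(\rho)\otimes|1\rangle\langle 1|.$$ It respects the no-signalling principle if, for every finite-dimensional system $B$, every density operator $\Psi$ on $(\mathbb C^d)^{\otimes n}\otimes B$ whose marginal on Alice's side $(\mathbb C^d)^{\otimes n}$ is supported on the symmetric subspace, and every finite POVM $(M_i)_i$ of Bob on $B$, Alice's average output $\sum_i q_i\,\mathcal C(\rho_i)$ does not depend on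 the choice of the POVM, where $q_i$ is the probability of Bob's outcome $i$ and $\rho_i$ is Alice's state conditioned on it. Its worst case global cloning fidelity is $$F_{\rm wc}(\mathcal R)=\inf_{\psi\in\mathcal S(d)}F\big(\mathcal R(|\psi\rangle\langle\psi|^{\otimes n}),|\psi\rangle\langle\psi|^{\otimes m}\big),\qquad F(\rho,\sigma)=\big(\operatorname{Tr}|\sqrt\rho\sqrt\sigma|\big)^2 .$$ For $0\le\varepsilon<1$, a weighted $\varepsilon$-approximate quantum $n$-design is a finite set $\mathcal W\subset\mathcal S(d)$ with a probability distribution $(p_\phi)_{\phi\in\mathcal W}$ such that $(1-\varepsilon)\rho_0^n\le\sum_{\phi\in\mathcal W}p_\phi|\phi\rangle\langle\phi|^{\otimes n}\le(1+\varepsilon)\rho_0^n$. (i) For every $d$, every $0\le\varepsilon<1$, every weighted $\varepsilon$-approximate quantum $n$-design $\mathcal W\subset\mathcal S(d)$, and every $n$-to-$m$ cloning oracle for $\mathcal S(d)$ that respects the no-signalling principle, $$F_{\rm wc}(\mathcal R)\le\frac{(1+\varepsilon)^2\,|\mathcal W|}{(1-\varepsilon)^2\,d[m]}.$$ (ii)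 For fixed $n$ and $m$, $F_{\rm wc}(\mathcal R)\le O(d^{\,n-m}\,\mathrm{polylog}\,d)$ uniformly over the oracles: there are constants $K\in\mathbb R$ and $k\in\mathbb N$, depending only on $n$ and $m$, such that for every $d\ge 2$ every $n$-to-$m$ cloning oracle for $\mathcal S(d)$ that respects the no-signalling principle satisfies $F_{\rm wc}(\mathcal R)\le K\,d^{\,n-m}(\log d)^k$. -/

import Mathlib

open scoped Kronecker MatrixOrder ComplexOrder

noncomputable section

namespace NoCloning

/-- Index set of the product basis of `(ℂ^d)^{⊗n}`; operators on `(ℂ^d)^{⊗n}` are matrices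
over it. -/
abbrev Idx (d n : ℕ) : Type := Fin n → Fin d

/-- Operators on `(ℂ^d)^{⊗n}`. -/
abbrev Op (d n : ℕ) : Type := Matrix (Idx d n) (Idx d n) ℂ

/-- The set `𝒮(d)` of pure states: unit vectors of `ℂ^d`. -/
abbrev PureState (d : ℕ) : Type := {ψ : EuclideanSpace ℂ (Fin d) // ‖ψ‖ = 1}

/-- A quantum state (density operator) on a finite-dimensional Hilbert space. -/
def IsState {ι : Type*} [Fintype ι] (ρ : Matrix ι ι ℂ) : Prop :=
  ρ.PosSemidef ∧ ρ.trace = 1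

/-- The vector `|ψ⟩^{⊗n}`. -/
def tensorPow {d : ℕ} (n : ℕ) (ψ : EuclideanSpace ℂ (Fin d)) : Idx d n → ℂ :=
  fun i => ∏ k, ψ (i k)

/-- The operator `|ψ⟩⟨ψ|^{⊗n}`. -/
def projPow {d : ℕ} (n : ℕ) (ψ : EuclideanSpace ℂ (Fin d)) : Op d n :=
  Matrix.vecMulVec (tensorPow n ψ) (star (tensorPow n ψ))

/-- The operator on `(ℂ^d)^{⊗n}` that permutes the tensor factors. -/
def permOp (d : ℕ) {n : ℕ} (π : Equiv.Perm (Fin n)) : Op d n :=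
  Matrix.of fun i j => if i = j ∘ π then 1 else 0

/-- The projector `P_sym^n` onto the symmetric subspace of `(ℂ^d)^{⊗n}`. -/
def symProj (d n : ℕ) : Op d n :=
  ((n.factorial : ℂ)⁻¹) • ∑ π : Equiv.Perm (Fin n), permOp d π

/-- `d[n]`, the dimension of the symmetric subspace. -/
def symDim (d n : ℕ) : ℕ := (d + n - 1).choose n

/-- `ρ_0^n = P_sym^n / d[n]`. -/
def symState (d n : ℕ) : Op d n := ((symDim d n : ℂ)⁻¹) • symProj d n

/-- The operator is supported on the symmetric subspace. -/
def IsSymSupported {d n : ℕ} (ρ : Op d n) : Prop :=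
  symProj d n * ρ * symProj d n = ρ

/-- The Uhlmann fidelity `F(ρ, σ) = (Tr |√ρ √σ|)²`. -/
def fidelity {ι : Type*} [Fintype ι] [DecidableEq ι] (ρ σ : Matrix ι ι ℂ) : ℝ :=
  (CFC.abs (CFC.sqrt ρ * CFC.sqrt σ)).trace.re ^ 2

/-- `ρ_𝒲^n = ∑_{φ ∈ 𝒲} p_φ |φ⟩⟨φ|^{⊗n}`. -/
def ensembleState {d : ℕ} (n : ℕ) (W : Finset (PureState d)) (w : PureState d → ℝ) : Op d n :=
  ∑ φ ∈ W, (w φ : ℂ) • projPow n φ.1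

/-- `({w_φ}, W)` is a weighted `ε`-approximate quantum `n`-design: the weights form a probability
distribution on `W` and `(1 - ε) ρ_0^n ≤ ρ_W^n ≤ (1 + ε) ρ_0^n` in the Loewner order. -/
structure IsWeightedApproxDesign {d : ℕ} (n : ℕ) (ε : ℝ)
    (W : Finset (PureState d)) (w : PureState d → ℝ) : Prop where
  nonneg : ∀ φ ∈ W, 0 ≤ w φ
  sum_eq_one : ∑ φ ∈ W, w φ = 1
  lower : ((1 - ε : ℝ) : ℂ) • symState d n ≤ ensembleState n W w
  upper : ensembleState n W w ≤ ((1 + ε : ℝ) : ℂ) • symState d n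

/-- A probabilistic `n`-to-`m` cloning oracle for all pure states of `ℂ^d`. No linearity,
positivity or continuity is required; `R` and `fail` only have to map states on the
symmetric subspace to states (their values elsewhere are irrelevant). -/
structure CloningOracle (d n m : ℕ) where
  /-- the success probability -/
  p : ℝ
  p_pos : 0 < p
  p_le_one : p ≤ 1
  /-- the output conditioned on success -/
  R : Op d n → Op d m
  R_isState : ∀ ρ, IsState ρ → IsSymSupported ρ → IsState (R ρ)
  /-- the output conditioned on failure -/
  fail : Op d n → Op d m
  fail_isState : ∀ ρ, IsState ρ → IsSymSupported ρ → IsState (fail ρ)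

/-- A POVM with outcomes `Fin k` on `ℂ^b`. -/
structure IsPOVM {b k : ℕ} (M : Fin k → Matrix (Fin b) (Fin b) ℂ) : Prop where
  posSemidef : ∀ i, (M i).PosSemidef
  sum_eq_one : ∑ i, M i = 1

/-- The partial trace over the second (Bob's) system. -/
def traceBob {α β : Type*} [Fintype β] (X : Matrix (α × β) (α × β) ℂ) : Matrix α α ℂ :=
  Matrix.of fun a a' => ∑ b, X (a, b) (a', b)

/-- Probability that Bob, measuring his part of the shared state `Ψ`, obtains the outcome with
POVM element `E`. -/
def outcomeProb {α β : Type*} [Fintype α] [Fintype β] [DecidableEq α]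
    (Ψ : Matrix (α × β) (α × β) ℂ) (E : Matrix β β ℂ) : ℝ :=
  (Ψ * ((1 : Matrix α α ℂ) ⊗ₖ E)).trace.re

/-- Alice's state conditioned on Bob obtaining the outcome with POVM element `E` (only meaningful
if this outcome has non-zero probability). -/
def conditionalState {α β : Type*} [Fintype α] [Fintype β] [DecidableEq α]
    (Ψ : Matrix (α × β) (α × β) ℂ) (E : Matrix β β ℂ) : Matrix α α ℂ :=
  ((outcomeProb Ψ E : ℂ)⁻¹) • traceBob (Ψ * ((1 : Matrix α α ℂ) ⊗ₖ E))

namespace CloningOracle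

variable {d n m : ℕ}

/-- The output `p R(ρ) ⊗ |0⟩⟨0| + (1 - p) ρ_⊥ ⊗ |1⟩⟨1|` of the oracle, including the flag that
tells success from failure. -/
def output (C : CloningOracle d n m) (ρ : Op d n) :
    Matrix (Idx d m × Fin 2) (Idx d m × Fin 2) ℂ :=
  (C.p : ℂ) • (C.R ρ ⊗ₖ Matrix.single 0 0 1) +
    ((1 - C.p : ℝ) : ℂ) • (C.fail ρ ⊗ₖ Matrix.single 1 1 1)

/-- Alice's state after the cloning oracle has been applied to her part of the shared state `Ψ`
and Bob has performed the measurement `M`, when Bob does not communicate his outcome. -/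
def aliceOutput (C : CloningOracle d n m) {b k : ℕ}
    (Ψ : Matrix (Idx d n × Fin b) (Idx d n × Fin b) ℂ)
    (M : Fin k → Matrix (Fin b) (Fin b) ℂ) :
    Matrix (Idx d m × Fin 2) (Idx d m × Fin 2) ℂ :=
  ∑ i, (outcomeProb Ψ (M i) : ℂ) • C.output (conditionalState Ψ (M i))

/-- The no-signalling principle: whatever state Alice and Bob share (Alice's part being on the
symmetric subspace, where the oracle acts), Alice's state after using the oracle does not depend
on Bob's choice of measurement. -/
def NoSignalling (C : CloningOracle d n m) : Prop :=
  ∀ (b : ℕ) (Ψ : Matrix (Idx d n × Fin b) (Idx d n × Fin b) ℂ),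
    IsState Ψ → IsSymSupported (traceBob Ψ) →
    ∀ (k l : ℕ) (M : Fin k → Matrix (Fin b) (Fin b) ℂ) (N : Fin l → Matrix (Fin b) (Fin b) ℂ),
      IsPOVM M → IsPOVM N → C.aliceOutput Ψ M = C.aliceOutput Ψ N

/-- The worst case global cloning fidelity
`F_wc(R) = min_ψ F(R(|ψ⟩⟨ψ|^{⊗n}), |ψ⟩⟨ψ|^{⊗m})` over all pure states of `ℂ^d`. -/
def worstCaseFidelity (C : CloningOracle d n m) : ℝ :=
  ⨅ ψ : PureState d, fidelity (C.R (projPow n ψ.1)) (projPow m ψ.1)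

end CloningOracle

end NoCloning

end

/-!
Both bounds follow from the optimal estimate `F_wc ≤ d[n] / d[m]`, valid for every cloning oracle
that respects no-signalling (`CloningOracle.NoSignalling.worstCaseFidelity_mul_symDim_le`).

*Affinity.* If Bob holds a classical bit telling which member of an ensemble Alice received, then
reading the bit or discarding it must give the same average output on Alice's side. So `R` is affine
on states of the symmetric subspace, and `q σ ≤ ρ` implies `q R(σ) ≤ R(ρ)`
(`CloningOracle.NoSignalling.smul_R_le`). As `|ψ⟩⟨ψ|^{⊗n} ≤ P_sym = d[n] ρ_0`, this gives
`R(|ψ⟩⟨ψ|^{⊗n}) ≤ d[n] R(ρ_0)` for every pure state `ψ`: the state `X = R(ρ_0)`, which does not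
depend on `ψ`, satisfies `F_wc ≤ d[n] ⟨ψ^{⊗m}| X |ψ^{⊗m}⟩`.

*Averaging.* The Gaussian average of `|v⟩⟨v|^{⊗m}` over `v ∈ ℂ^d` is proportional to `P_sym`
(`integral_star_tensorPow_mul_tensorPow`): up to a constant, both
have entries `∏ a, c_a!` when the row and column
multi-indices take each value `a` equally often, `c_a` times, and zero otherwise. Averaging the
inequality, which holds for vectors of any norm once made homogeneous, yields
`F_wc Tr P_sym ≤ d[n] Tr (X P_sym) ≤ d[n]`, where `Tr P_sym = d[m]` by Burnside's lemma
(`trace_symProj`).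

*Designs.* The upper bound in the definition of a design bounds each weight by `(1 + ε) / d[n]`;
summing over the design gives `d[n] ≤ (1 + ε) |W|` (`IsWeightedApproxDesign.symDim_le`), hence the
first part. The second part uses `d[n] ≤ d ^ n` and `d ^ m ≤ m! d[m]`.
-/

namespace NoCloning

variable {d n m : ℕ}

/-! ### The symmetric projector -/

theorem permOp_mul_permOp (π σ : Equiv.Perm (Fin n)) :
    permOp d π * permOp d σ = permOp d (σ * π) := by
  ext i k
  simp only [permOp, Matrix.mul_apply, Matrix.of_apply]
  rw [Finset.sum_eq_single (k ∘ σ)]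
  · simp [Function.comp_assoc, Equiv.Perm.coe_mul]
    rfl
  · intro j _ hj
    simp [hj]
  · simp

theorem conjTranspose_permOp (π : Equiv.Perm (Fin n)) :
    (permOp d π).conjTranspose = permOp d π⁻¹ := by
  ext i j
  have h : j = i ∘ π ↔ i = j ∘ (π⁻¹ : Equiv.Perm (Fin n)) := by
    constructor <;> rintro rfl <;> ext x <;> simp
  rw [Matrix.conjTranspose_apply, permOp, permOp, Matrix.of_apply, Matrix.of_apply]
  simp only [h]
  split_ifs <;> simp

theorem permOp_mul_symProj (π : Equiv.Perm (Fin n)) :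
    permOp d π * symProj d n = symProj d n := by
  simp only [symProj, Matrix.mul_smul, Matrix.mul_sum, permOp_mul_permOp]
  congr 1
  exact Equiv.sum_comp (Equiv.mulRight π) (fun σ => permOp d σ)

theorem symProj_mul_self : symProj d n * symProj d n = symProj d n := by
  conv_lhs => enter [1]; rw [symProj]
  simp only [Matrix.smul_mul, Matrix.sum_mul, permOp_mul_symProj, Finset.sum_const,
    Finset.card_univ, Fintype.card_perm, Fintype.card_fin]
  rw [← Nat.cast_smul_eq_nsmul ℂ, smul_smul, inv_mul_cancel₀, one_smul]
  exact_mod_cast n.factorial_ne_zero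

theorem symProj_isHermitian : (symProj d n).IsHermitian := by
  simp only [Matrix.IsHermitian, symProj, Matrix.conjTranspose_smul, Matrix.conjTranspose_sum,
    conjTranspose_permOp]
  congr 1
  · simp
  · exact Equiv.sum_comp (Equiv.inv _) (fun σ => permOp d σ)

/-- A Hermitian idempotent is positive semidefinite. -/
theorem _root_.Matrix.IsHermitian.posSemidef_of_mul_self {ι : Type*} [Fintype ι]
    {Q : Matrix ι ι ℂ} (hQ : Q.IsHermitian) (h : Q * Q = Q) : Q.PosSemidef := by
  have := Matrix.posSemidef_conjTranspose_mul_self Q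
  rwa [hQ.eq, h] at this

theorem symProj_posSemidef : (symProj d n).PosSemidef :=
  symProj_isHermitian.posSemidef_of_mul_self symProj_mul_self

theorem permOp_mulVec_tensorPow (π : Equiv.Perm (Fin n)) (ψ : EuclideanSpace ℂ (Fin d)) :
    (permOp d π).mulVec (tensorPow n ψ) = tensorPow n ψ := by
  ext i
  simp only [Matrix.mulVec, dotProduct, permOp, Matrix.of_apply, ite_mul, one_mul, zero_mul]
  rw [Finset.sum_eq_single (i ∘ (π⁻¹ : Equiv.Perm (Fin n)))]
  · rw [if_pos (by ext x; simp)]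
    exact Equiv.prod_comp (π⁻¹) (fun k => ψ (i k))
  · intro j _ hj
    rw [if_neg]
    rintro rfl
    exact hj (by ext x; simp)
  · simp

theorem symProj_mulVec_tensorPow (ψ : EuclideanSpace ℂ (Fin d)) :
    (symProj d n).mulVec (tensorPow n ψ) = tensorPow n ψ := by
  simp only [symProj, Matrix.smul_mulVec, Matrix.sum_mulVec, permOp_mulVec_tensorPow,
    Finset.sum_const, Finset.card_univ, Fintype.card_perm, Fintype.card_fin]
  rw [← Nat.cast_smul_eq_nsmul ℂ, smul_smul, inv_mul_cancel₀, one_smul]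
  exact_mod_cast n.factorial_ne_zero

theorem symProj_mul_projPow (ψ : EuclideanSpace ℂ (Fin d)) :
    symProj d n * projPow n ψ = projPow n ψ := by
  rw [projPow, Matrix.mul_vecMulVec, symProj_mulVec_tensorPow]

theorem projPow_isHermitian (ψ : EuclideanSpace ℂ (Fin d)) : (projPow n ψ).IsHermitian :=
  (Matrix.posSemidef_vecMulVec_self_star _).1

theorem projPow_mul_symProj (ψ : EuclideanSpace ℂ (Fin d)) :
    projPow n ψ * symProj d n = projPow n ψ := by
  have := congrArg Matrix.conjTranspose (symProj_mul_projPow (n := n) ψ)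
  rwa [Matrix.conjTranspose_mul, (projPow_isHermitian ψ).eq, symProj_isHermitian.eq] at this

theorem projPow_isSymSupported (ψ : EuclideanSpace ℂ (Fin d)) :
    IsSymSupported (projPow n ψ) := by
  rw [IsSymSupported, symProj_mul_projPow, projPow_mul_symProj]

theorem star_tensorPow_dotProduct (ψ : EuclideanSpace ℂ (Fin d)) :
    star (tensorPow n ψ) ⬝ᵥ tensorPow n ψ = ((‖ψ‖ ^ 2) ^ n : ℝ) := by
  have h : ∀ i : Idx d n, star (tensorPow n ψ) i * tensorPow n ψ i
      = ∏ k, ((‖ψ (i k)‖ ^ 2 : ℝ) : ℂ) := by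
    intro i
    simp only [tensorPow, Pi.star_apply, star_prod, ← Finset.prod_mul_distrib]
    refine Finset.prod_congr rfl fun k _ => ?_
    rw [mul_comm]
    simpa using Complex.mul_conj' (ψ (i k))
  simp only [dotProduct, h]
  rw [EuclideanSpace.norm_sq_eq]
  push_cast
  exact (Fintype.sum_pow (fun a => (‖ψ a‖ : ℂ) ^ 2) n).symm

theorem projPow_mul_self {ψ : EuclideanSpace ℂ (Fin d)} (hψ : ‖ψ‖ = 1) :
    projPow n ψ * projPow n ψ = projPow n ψ := by
  rw [projPow, Matrix.vecMulVec_mul_vecMulVec, star_tensorPow_dotProduct, hψ]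
  simp

theorem projPow_isState {ψ : EuclideanSpace ℂ (Fin d)} (hψ : ‖ψ‖ = 1) :
    IsState (projPow n ψ) := by
  refine ⟨Matrix.posSemidef_vecMulVec_self_star _, ?_⟩
  rw [projPow, Matrix.trace_vecMulVec, dotProduct_comm, star_tensorPow_dotProduct, hψ]
  simp

theorem projPow_le_symProj {ψ : EuclideanSpace ℂ (Fin d)} (hψ : ‖ψ‖ = 1) :
    projPow n ψ ≤ symProj d n := by
  rw [Matrix.le_iff]
  refine (symProj_isHermitian.sub (projPow_isHermitian ψ)).posSemidef_of_mul_self ?_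
  rw [sub_mul, mul_sub, mul_sub, symProj_mul_self, symProj_mul_projPow, projPow_mul_symProj,
    projPow_mul_self hψ]
  simp

theorem tensorPow_smul (c : ℂ) (ψ : EuclideanSpace ℂ (Fin d)) :
    tensorPow n (c • ψ) = c ^ n • tensorPow n ψ := by
  ext i
  simp [tensorPow, Finset.prod_mul_distrib]

/-- Compressing a positive operator by the symmetric projector does not increase its trace. -/
theorem trace_mul_symProj_le {X : Op d n} (hX : X.PosSemidef) :
    (X * symProj d n).trace.re ≤ X.trace.re := by
  have hQ : (1 - symProj d n : Op d n).IsHermitian := Matrix.isHermitian_one.sub symProj_isHermitian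
  have h := (hX.mul_mul_conjTranspose_same (1 - symProj d n : Op d n)).trace_nonneg
  rw [hQ.eq, Matrix.trace_mul_comm, ← mul_assoc, show
    (1 - symProj d n : Op d n) * (1 - symProj d n) = 1 - symProj d n by
      simp [sub_mul, mul_sub, symProj_mul_self], sub_mul, one_mul, Matrix.trace_sub,
      Matrix.trace_mul_comm (symProj d n)] at h
  have := (Complex.le_def.1 h).1
  simp at this
  linarith

/-! ### Entries and trace of the symmetric projector -/

/-- Number of positions at which the multi-index `i` takes the value `a`. -/
def mult (i : Idx d n) (a : Fin d) : ℕ := Fintype.card {k // i k = a}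

theorem exists_perm_of_mult_eq {i j : Idx d n} (h : mult i = mult j) :
    ∃ π : Equiv.Perm (Fin n), i = j ∘ π := by
  have e : ∀ a, {k // i k = a} ≃ {k // j k = a} := fun a => Fintype.equivOfCardEq (congrFun h a)
  exact ⟨Equiv.ofFiberEquiv e, funext fun k => (Equiv.ofFiberEquiv_map e k).symm⟩

theorem mult_comp (j : Idx d n) (π : Equiv.Perm (Fin n)) : mult (j ∘ π) = mult j :=
  funext fun _ => Fintype.card_congr (π.subtypeEquiv fun _ => Iff.rfl)

theorem symProj_apply (i j : Idx d n) :
    (n.factorial : ℂ) * symProj d n i j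
      = if mult i = mult j then ∏ a, ((mult j a).factorial : ℂ) else 0 := by
  have hn : (n.factorial : ℂ) ≠ 0 := by exact_mod_cast n.factorial_ne_zero
  have hsum : (n.factorial : ℂ) * symProj d n i j
      = (Fintype.card {π : Equiv.Perm (Fin n) // i = j ∘ π} : ℂ) := by
    rw [symProj, Matrix.smul_apply, smul_eq_mul, mul_inv_cancel_left₀ hn, Matrix.sum_apply]
    simp [permOp, Fintype.card_subtype]
  rw [hsum]
  split_ifs with h
  · obtain ⟨σ, rfl⟩ := exists_perm_of_mult_eq h
    have e : {π : Equiv.Perm (Fin n) // j ∘ σ = j ∘ π} ≃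
        {g : Equiv.Perm (Fin n) // j ∘ g = j} :=
      (Equiv.mulRight σ⁻¹).subtypeEquiv fun π => by
        constructor
        · intro hp
          ext x
          simpa using congrArg Fin.val (congrFun hp (σ⁻¹ x)).symm
        · intro hp
          ext x
          simpa using congrArg Fin.val (congrFun hp (σ x)).symm
    rw [Fintype.card_congr e, DomMulAct.stabilizer_card]
    push_cast
    rfl
  · have : IsEmpty {π : Equiv.Perm (Fin n) // i = j ∘ π} :=
      ⟨fun π => h (by rw [π.2, mult_comp])⟩
    simp

/-- The multiset of values of a multi-index; it classifies multi-indices up to permutation of the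
positions. -/
def toSym (i : Idx d n) : Sym (Fin d) n :=
  ⟨Finset.univ.val.map i, by simp⟩

theorem toSym_surjective : Function.Surjective (toSym : Idx d n → Sym (Fin d) n) := by
  rintro ⟨s, hs⟩
  induction s using Quotient.inductionOn with
  | h l =>
    have hl : l.length = n := by simpa using hs
    subst hl
    refine ⟨l.get, Subtype.ext ?_⟩
    change Multiset.map l.get (Finset.univ : Finset (Fin l.length)).val = (l : Multiset _)
    rw [Fin.univ_val_map, List.ofFn_get]

theorem toSym_eq_iff {i j : Idx d n} : toSym i = toSym j ↔ ∃ π : Equiv.Perm (Fin n), i = j ∘ π := by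
  constructor
  · intro h
    refine exists_perm_of_mult_eq (funext fun a => ?_)
    have := congrArg (Multiset.count a) (congrArg Subtype.val h)
    simp only [toSym, Multiset.count_map] at this
    rw [mult, mult, Fintype.card_subtype, Fintype.card_subtype]
    simpa [Finset.card, Finset.filter, eq_comm] using this
  · rintro ⟨π, rfl⟩
    refine Subtype.ext ?_
    change Finset.univ.val.map (j ∘ π) = Finset.univ.val.map j
    rw [← Multiset.map_map, Multiset.map_univ_val_equiv]

/-- The dimension count for the symmetric subspace, by Burnside's lemma: the permutation operators
have as traces the numbers of fixed multi-indices, and the orbits are the multisets of size `n`. -/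
theorem trace_symProj : (symProj d n).trace = symDim d n := by
  have hn : (n.factorial : ℂ) ≠ 0 := by exact_mod_cast n.factorial_ne_zero
  have e : Quotient (MulAction.orbitRel (Equiv.Perm (Fin n))ᵈᵐᵃ (Idx d n)) ≃ Sym (Fin d) n := by
    have hrel : ∀ i j : Idx d n, MulAction.orbitRel (Equiv.Perm (Fin n))ᵈᵐᵃ (Idx d n) i j
        ↔ toSym i = toSym j := by
      intro i j
      rw [MulAction.orbitRel_apply, MulAction.mem_orbit_iff, toSym_eq_iff]
      exact ⟨fun ⟨g, hg⟩ => ⟨DomMulAct.mk.symm g, hg.symm⟩,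
        fun ⟨g, hg⟩ => ⟨DomMulAct.mk g, hg.symm⟩⟩
    refine Equiv.ofBijective (Quotient.lift toSym fun i j h => (hrel i j).1 h) ⟨?_, ?_⟩
    · intro x y
      induction x, y using Quotient.inductionOn₂ with
      | _ i j => exact fun h => Quotient.sound ((hrel i j).2 h)
    · intro s
      obtain ⟨i, hi⟩ := toSym_surjective s
      exact ⟨⟦i⟧, hi⟩
  classical
  have : Fintype (Quotient (MulAction.orbitRel (Equiv.Perm (Fin n))ᵈᵐᵃ (Idx d n))) :=
    Fintype.ofEquiv _ e.symm
  have : Fintype (Equiv.Perm (Fin n))ᵈᵐᵃ := Fintype.ofEquiv _ DomMulAct.mk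
  have hB := MulAction.sum_card_fixedBy_eq_card_orbits_mul_card_group
    (Equiv.Perm (Fin n))ᵈᵐᵃ (Idx d n)
  rw [Fintype.card_congr e, Sym.card_sym_eq_choose, Fintype.card_fin,
    Fintype.card_congr (DomMulAct.mk (M := Equiv.Perm (Fin n))).symm, Fintype.card_perm,
    Fintype.card_fin] at hB
  rw [symProj, Matrix.trace_smul, Matrix.trace_sum, smul_eq_mul, inv_mul_eq_iff_eq_mul₀ hn,
    symDim, mul_comm]
  rw [← Nat.cast_mul, ← hB, Nat.cast_sum, ← Equiv.sum_comp DomMulAct.mk]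
  refine Finset.sum_congr rfl fun π _ => ?_
  simp only [Matrix.trace, Matrix.diag, permOp, Matrix.of_apply, Finset.sum_boole]
  rw [← Fintype.card_subtype]
  congr 1
  exact Fintype.card_congr (Equiv.subtypeEquivRight fun i => eq_comm)

theorem symDim_pos (hd : 0 < d) : 0 < symDim d n := Nat.choose_pos (by omega)

/-! ### Fidelity with a pure state -/

theorem projPow_mul_mul_projPow (X : Op d m) (ψ : EuclideanSpace ℂ (Fin d)) :
    projPow m ψ * X * projPow m ψ
      = (star (tensorPow m ψ) ⬝ᵥ X.mulVec (tensorPow m ψ)) • projPow m ψ := by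
  rw [projPow, Matrix.mul_assoc, Matrix.mul_vecMulVec, Matrix.vecMulVec_mul_vecMulVec,
    Matrix.vecMulVec_smul]

/-- The fidelity of `ρ` with the pure state `|ψ⟩⟨ψ|^{⊗m}` is the expectation value of `ρ`. -/
theorem fidelity_projPow {ρ : Op d m} (hρ : ρ.PosSemidef) {ψ : EuclideanSpace ℂ (Fin d)}
    (hψ : ‖ψ‖ = 1) :
    fidelity ρ (projPow m ψ) = (star (tensorPow m ψ) ⬝ᵥ ρ.mulVec (tensorPow m ψ)).re := by
  have hP : (0 : Op d m) ≤ projPow m ψ := (projPow_isState hψ).1.nonneg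
  set c := star (tensorPow m ψ) ⬝ᵥ ρ.mulVec (tensorPow m ψ) with hc
  have hc0 : 0 ≤ c := hρ.dotProduct_mulVec_nonneg _
  have hcre : c = (c.re : ℂ) := (Complex.eq_re_of_ofReal_le hc0)
  have hre : 0 ≤ c.re := (Complex.le_def.1 hc0).1
  have h1 : CFC.sqrt (projPow m ψ) = projPow m ψ := CFC.sqrt_unique (projPow_mul_self hψ) hP
  have h2 : CFC.abs (CFC.sqrt ρ * CFC.sqrt (projPow m ψ))
      = ((Real.sqrt c.re : ℝ) : ℂ) • projPow m ψ := by
    rw [CFC.abs]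
    refine CFC.sqrt_unique ?_ ?_
    · have hs : star (CFC.sqrt ρ) = CFC.sqrt ρ := (CFC.sqrt_nonneg ρ).isSelfAdjoint.star_eq
      have hp : star (projPow m ψ) = projPow m ψ := projPow_isHermitian ψ
      rw [h1, star_mul, hs, hp, mul_assoc, ← mul_assoc (CFC.sqrt ρ),
        CFC.sqrt_mul_sqrt_self ρ hρ.nonneg, ← mul_assoc, projPow_mul_mul_projPow, ← hc,
        smul_mul_smul_comm, projPow_mul_self hψ, ← Complex.ofReal_mul, Real.mul_self_sqrt hre,
        ← hcre]
    · exact ((projPow_isState hψ).1.smul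
        (Complex.zero_le_real.2 (Real.sqrt_nonneg _))).nonneg
  rw [fidelity, h2, Matrix.trace_smul, (projPow_isState hψ).2, smul_eq_mul, mul_one,
    Complex.ofReal_re, Real.sq_sqrt hre]

/-! ### Consequences of no-signalling -/

section Steering

variable {α β : Type*} [Fintype β]

theorem traceBob_add (X Y : Matrix (α × β) (α × β) ℂ) :
    traceBob (X + Y) = traceBob X + traceBob Y := by
  ext a a'
  simp [traceBob, Finset.sum_add_distrib]

theorem trace_traceBob [Fintype α] (X : Matrix (α × β) (α × β) ℂ) : (traceBob X).trace = X.trace := by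
  simp [traceBob, Matrix.trace, Fintype.sum_prod_type]

theorem traceBob_kronecker (A : Matrix α α ℂ) (B : Matrix β β ℂ) :
    traceBob (A ⊗ₖ B) = B.trace • A := by
  ext a a'
  simp [traceBob, Matrix.trace, ← Finset.mul_sum, mul_comm]

/-- The state `A ⊗ |0⟩⟨0| + B ⊗ |1⟩⟨1|` in which Bob holds a classical bit. -/
def classicalBit (A B : Matrix α α ℂ) : Matrix (α × Fin 2) (α × Fin 2) ℂ :=
  A ⊗ₖ Matrix.single 0 0 1 + B ⊗ₖ Matrix.single 1 1 1

theorem traceBob_classicalBit_mul [Fintype α] [DecidableEq α] (A B : Matrix α α ℂ)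
    (E : Matrix (Fin 2) (Fin 2) ℂ) :
    traceBob (classicalBit A B * ((1 : Matrix α α ℂ) ⊗ₖ E)) = E 0 0 • A + E 1 1 • B := by
  rw [classicalBit, add_mul, ← Matrix.mul_kronecker_mul, ← Matrix.mul_kronecker_mul, traceBob_add,
    traceBob_kronecker, traceBob_kronecker]
  simp [Matrix.trace_single_mul]

theorem outcomeProb_classicalBit [Fintype α] [DecidableEq α] (A B : Matrix α α ℂ) (E : Matrix (Fin 2) (Fin 2) ℂ) :
    outcomeProb (classicalBit A B) E = (E 0 0 * A.trace + E 1 1 * B.trace).re := by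
  rw [outcomeProb, ← trace_traceBob, traceBob_classicalBit_mul]
  simp [Matrix.trace_add, Matrix.trace_smul]

theorem posSemidef_single_self {ι : Type*} [Fintype ι] [DecidableEq ι] (i : ι) :
    (Matrix.single i i (1 : ℂ)).PosSemidef := by
  rw [← Matrix.diagonal_single]
  exact Matrix.PosSemidef.diagonal (Pi.single_nonneg.2 zero_le_one)

theorem classicalBit_posSemidef [Fintype α] {A B : Matrix α α ℂ} (hA : A.PosSemidef) (hB : B.PosSemidef) :
    (classicalBit A B).PosSemidef := by
  exact (hA.kronecker (posSemidef_single_self 0)).add (hB.kronecker (posSemidef_single_self 1))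

end Steering

namespace CloningOracle

theorem output_submatrix (C : CloningOracle d n m) (ρ : Op d n) :
    (C.output ρ).submatrix (fun i => (i, (0 : Fin 2))) (fun i => (i, (0 : Fin 2)))
      = (C.p : ℂ) • C.R ρ := by
  ext i j
  simp [output]

/-- Bob can hold a bit telling which member of an ensemble Alice received. Reading the bit or
not must give the same average output, so `R` is affine; hence if `q σ ≤ ρ`, then the output on
`ρ` contains the output on `σ` with weight `q`. -/
theorem NoSignalling.smul_R_le {C : CloningOracle d n m} (hC : C.NoSignalling) {ρ σ : Op d n}
    (hρ : IsState ρ) (hσ : IsState σ) (hρs : IsSymSupported ρ) (hσs : IsSymSupported σ)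
    {q : ℝ} (hq : 0 < q) (h : (q : ℂ) • σ ≤ ρ) : (q : ℂ) • C.R σ ≤ C.R ρ := by
  have hrest : (ρ - (q : ℂ) • σ).PosSemidef := Matrix.le_iff.1 h
  have htr : (ρ - (q : ℂ) • σ).trace = ((1 - q : ℝ) : ℂ) := by
    simp [Matrix.trace_sub, Matrix.trace_smul, hρ.2, hσ.2]
  have hq1 : 0 ≤ 1 - q := by
    have := hrest.trace_nonneg
    rwa [htr, Complex.zero_le_real] at this
  have hqc : (q : ℂ) ≠ 0 := by exact_mod_cast hq.ne'
  set Ψ := classicalBit ((q : ℂ) • σ) (ρ - (q : ℂ) • σ) with hΨ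
  have hmarg : traceBob Ψ = ρ := by
    have := traceBob_classicalBit_mul ((q : ℂ) • σ) (ρ - (q : ℂ) • σ) 1
    rw [Matrix.one_kronecker_one, Matrix.mul_one] at this
    rw [hΨ, this]
    simp
  have hΨs : IsState Ψ :=
    ⟨classicalBit_posSemidef (hσ.1.smul (Complex.zero_le_real.2 hq.le)) hrest, by
      rw [← trace_traceBob, hmarg, hρ.2]⟩
  let M : Fin 2 → Matrix (Fin 2) (Fin 2) ℂ := fun i => Matrix.single i i 1
  let N : Fin 1 → Matrix (Fin 2) (Fin 2) ℂ := fun _ => 1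
  have hM : IsPOVM M := by
    refine ⟨fun i => posSemidef_single_self i, ?_⟩
    ext i j
    fin_cases i <;> fin_cases j <;> simp [M]
  have hN : IsPOVM N := ⟨fun _ => Matrix.PosSemidef.one, by simp [N]⟩
  have hp0 : outcomeProb Ψ (M 0) = q := by
    simp [hΨ, outcomeProb_classicalBit, M, Matrix.trace_smul, hσ.2]
  have hp1 : outcomeProb Ψ (M 1) = 1 - q := by
    rw [hΨ, outcomeProb_classicalBit, htr]
    simp [M]
  have hpN : outcomeProb Ψ (N 0) = 1 := by
    rw [hΨ, outcomeProb_classicalBit, htr, Matrix.trace_smul, hσ.2]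
    simp [N]
  have hs0 : conditionalState Ψ (M 0) = σ := by
    rw [conditionalState, hp0, hΨ, traceBob_classicalBit_mul]
    simp only [M, Matrix.single_apply_same, one_smul, zero_ne_one, not_false_eq_true,
      Matrix.single_apply_of_ne, false_and, zero_smul, add_zero]
    rw [inv_smul_smul₀ hqc]
  have hsN : conditionalState Ψ (N 0) = ρ := by
    rw [conditionalState, hpN, hΨ, traceBob_classicalBit_mul]
    simp [N]
  have key := congrArg
    (fun X => X.submatrix (fun i => (i, (0 : Fin 2))) (fun i => (i, (0 : Fin 2))))
    (hC 2 Ψ hΨs (hmarg ▸ hρs) 2 1 M N hM hN)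
  simp only [aliceOutput, Fin.sum_univ_two, Fin.sum_univ_one, Fin.isValue, hp0, hp1, hpN, hs0, hsN,
    Matrix.submatrix_add, Matrix.submatrix_smul, Pi.add_apply, Pi.smul_apply,
    output_submatrix] at key
  have hpc : (C.p : ℂ) ≠ 0 := by exact_mod_cast C.p_pos.ne'
  have key' : C.R ρ - (q : ℂ) • C.R σ
      = ((1 - q : ℝ) : ℂ) • C.R (conditionalState Ψ (M 1)) := by
    refine smul_right_injective _ hpc ?_
    simp only [smul_sub]
    rw [sub_eq_iff_eq_add, smul_comm (C.p : ℂ) ((1 - q : ℝ) : ℂ), smul_comm (C.p : ℂ) (q : ℂ),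
      add_comm, key]
    simp
  rw [Matrix.le_iff, key']
  -- If `q = 1`, the second outcome has probability zero and its conditional state is meaningless,
  -- but then it does not contribute.
  rcases hq1.eq_or_lt with h0 | h0
  · rw [← h0]
    simpa using Matrix.PosSemidef.zero
  · have h0c : ((1 - q : ℝ) : ℂ) ≠ 0 := by exact_mod_cast h0.ne'
    have hs1 : conditionalState Ψ (M 1) = ((1 - q : ℝ) : ℂ)⁻¹ • (ρ - (q : ℂ) • σ) := by
      rw [conditionalState, hp1, hΨ, traceBob_classicalBit_mul]
      simp [M]
    have hstate : IsState (conditionalState Ψ (M 1)) := by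
      rw [hs1, ← Complex.ofReal_inv]
      refine ⟨hrest.smul (Complex.zero_le_real.2 (inv_nonneg.2 hq1)), ?_⟩
      rw [Matrix.trace_smul, htr, smul_eq_mul, Complex.ofReal_inv, inv_mul_cancel₀ h0c]
    have hsym : IsSymSupported (conditionalState Ψ (M 1)) := by
      rw [IsSymSupported, hs1, Matrix.mul_smul, Matrix.smul_mul, mul_sub, sub_mul, Matrix.mul_smul,
        Matrix.smul_mul, hρs, hσs]
    exact (C.R_isState _ hstate hsym).1.smul (Complex.zero_le_real.2 hq1)

end CloningOracle

/-! ### Gaussian moments -/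

open MeasureTheory

theorem integral_norm_pow_mul_exp (k : ℕ) :
    ∫ z : ℂ, ‖z‖ ^ k * Real.exp (-‖z‖ ^ 2) = Real.pi * Real.Gamma ((k + 2 : ℝ) / 2) := by
  have := Complex.integral_rpow_mul_exp_neg_rpow (p := 2) (q := k) one_le_two
    (by linarith [k.cast_nonneg (α := ℝ)])
  simpa using this

theorem integrable_norm_pow_mul_exp (k : ℕ) :
    Integrable fun z : ℂ => ‖z‖ ^ k * Real.exp (-‖z‖ ^ 2) := by
  refine Integrable.of_integral_ne_zero ?_
  rw [integral_norm_pow_mul_exp]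
  exact (mul_pos Real.pi_pos (Real.Gamma_pos_of_pos (by positivity))).ne'

theorem integrable_star_pow_mul_pow_mul_exp (a b : ℕ) :
    Integrable fun z : ℂ => star z ^ a * z ^ b * (Real.exp (-‖z‖ ^ 2) : ℂ) := by
  refine (integrable_norm_pow_mul_exp (a + b)).mono (by fun_prop) (ae_of_all _ fun z => ?_)
  simp [pow_add, Complex.norm_exp, -Complex.ofReal_pow]

/-- The mixed moments of the complex Gaussian vanish off the diagonal because it is invariant under
rotations. -/
theorem integral_star_pow_mul_pow_mul_exp (a b : ℕ) :
    ∫ z : ℂ, star z ^ a * z ^ b * (Real.exp (-‖z‖ ^ 2) : ℂ)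
      = if a = b then (Real.pi : ℂ) * (a.factorial : ℂ) else 0 := by
  split_ifs with h
  · subst h
    have h1 : ∀ z : ℂ, star z ^ a * z ^ a * (Real.exp (-‖z‖ ^ 2) : ℂ)
        = ((‖z‖ ^ (2 * a) * Real.exp (-‖z‖ ^ 2) : ℝ) : ℂ) := by
      intro z
      rw [← mul_pow, mul_comm (star z), ← starRingEnd_apply, Complex.mul_conj']
      push_cast
      ring
    simp only [h1]
    rw [integral_complex_ofReal, integral_norm_pow_mul_exp]
    have : ((2 * a : ℕ) + 2 : ℝ) / 2 = a + 1 := by push_cast; ring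
    rw [this, Real.Gamma_nat_eq_factorial]
    push_cast
    rfl
  -- The angle `θ` is chosen so that `exp (i θ (b - a)) = -1`.
  · set θ : ℝ := Real.pi / ((b : ℝ) - a) with hθ
    have hab : (b : ℝ) - a ≠ 0 := sub_ne_zero.2 (by exact_mod_cast Ne.symm h)
    have hrot : ∀ z : ℂ, rotation (Circle.exp θ) z = Complex.exp (θ * Complex.I) * z := by
      intro z
      simp [rotation_apply]
    have hphase : star (Complex.exp (θ * Complex.I)) ^ a * Complex.exp (θ * Complex.I) ^ b
        = -1 := by
      rw [← starRingEnd_apply, ← Complex.exp_conj, ← Complex.exp_nat_mul, ← Complex.exp_nat_mul,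
        ← Complex.exp_add, ← Complex.exp_pi_mul_I]
      congr 1
      have : (Real.pi : ℂ) = θ * (b - a) := by
        rw [hθ]
        have hab' : (b : ℂ) - a ≠ 0 := by exact_mod_cast hab
        push_cast
        field_simp
      rw [this]
      simp
      ring
    have hinv := (rotation (Circle.exp θ)).measurePreserving.integral_comp
      (rotation (Circle.exp θ)).toHomeomorph.measurableEmbedding
      (fun z : ℂ => star z ^ a * z ^ b * (Real.exp (-‖z‖ ^ 2) : ℂ))
    have hneg : ∀ z : ℂ, star (rotation (Circle.exp θ) z) ^ a * rotation (Circle.exp θ) z ^ b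
        * (Real.exp (-‖rotation (Circle.exp θ) z‖ ^ 2) : ℂ)
        = -(star z ^ a * z ^ b * (Real.exp (-‖z‖ ^ 2) : ℂ)) := by
      intro z
      rw [LinearIsometryEquiv.norm_map, hrot, star_mul', mul_pow, mul_pow, mul_mul_mul_comm,
        hphase]
      ring
    simp only [hneg, integral_neg] at hinv
    exact self_eq_neg.1 hinv.symm

/-- The Gaussian weight `e^{-‖v‖²}` on `ℂ^d`, in product form. -/
noncomputable def gaussWeight (v : Fin d → ℂ) : ℝ := ∏ a, Real.exp (-‖v a‖ ^ 2)

theorem prod_comp_eq_prod_pow_mult (i : Idx d m) (f : Fin d → ℂ) :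
    ∏ k, f (i k) = ∏ a, f a ^ mult i a := by
  rw [← Finset.prod_fiberwise (s := Finset.univ) (g := i)]
  refine Finset.prod_congr rfl fun a _ => ?_
  rw [Finset.prod_congr rfl fun k hk => by rw [(Finset.mem_filter.1 hk).2], Finset.prod_const,
    mult, Fintype.card_subtype]

theorem star_tensorPow_mul_tensorPow_mul_gaussWeight (i j : Idx d m) (v : Fin d → ℂ) :
    star (tensorPow m (WithLp.toLp 2 v) i) * tensorPow m (WithLp.toLp 2 v) j * (gaussWeight v : ℂ)
      = ∏ a, (star (v a) ^ mult i a * v a ^ mult j a * (Real.exp (-‖v a‖ ^ 2) : ℂ)) := by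
  simp only [tensorPow, star_prod, gaussWeight, Finset.prod_mul_distrib, Complex.ofReal_prod]
  rw [prod_comp_eq_prod_pow_mult j v, prod_comp_eq_prod_pow_mult i fun a => star (v a)]

theorem integrable_star_tensorPow_mul_tensorPow (i j : Idx d m) :
    Integrable fun v : Fin d → ℂ => star (tensorPow m (WithLp.toLp 2 v) i)
      * tensorPow m (WithLp.toLp 2 v) j * (gaussWeight v : ℂ) := by
  simp only [star_tensorPow_mul_tensorPow_mul_gaussWeight]
  exact Integrable.fintype_prod fun a => integrable_star_pow_mul_pow_mul_exp (mult i a) (mult j a)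

/-- The Gaussian average of `|v⟩⟨v|^{⊗m}` is proportional to the symmetric projector. -/
theorem integral_star_tensorPow_mul_tensorPow (i j : Idx d m) :
    ∫ v : Fin d → ℂ, star (tensorPow m (WithLp.toLp 2 v) i)
      * tensorPow m (WithLp.toLp 2 v) j * (gaussWeight v : ℂ)
      = (Real.pi : ℂ) ^ d * (m.factorial * symProj d m j i) := by
  simp only [star_tensorPow_mul_tensorPow_mul_gaussWeight]
  rw [volume_pi, integral_fintype_prod_eq_prod (𝕜 := ℂ) (fun a (z : ℂ) =>
    star z ^ mult i a * z ^ mult j a * (Real.exp (-‖z‖ ^ 2) : ℂ))]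
  simp only [integral_star_pow_mul_pow_mul_exp, symProj_apply]
  split_ifs with h
  · simp [h, Finset.prod_mul_distrib]
  · obtain ⟨a, ha⟩ := Function.ne_iff.1 h
    rw [mul_zero]
    exact Finset.prod_eq_zero (Finset.mem_univ a) (if_neg (Ne.symm ha))

/-- An operator with nonnegative expectation on all the vectors `|ψ⟩^{⊗m}` has nonnegative trace
on the symmetric subspace. -/
theorem trace_mul_symProj_nonneg {Y : Op d m}
    (hY : ∀ ψ : EuclideanSpace ℂ (Fin d),
      0 ≤ (star (tensorPow m ψ) ⬝ᵥ Y.mulVec (tensorPow m ψ)).re) :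
    0 ≤ (Y * symProj d m).trace.re := by
  have hexp : ∀ v : Fin d → ℂ, (star (tensorPow m (WithLp.toLp 2 v)) ⬝ᵥ
      Y.mulVec (tensorPow m (WithLp.toLp 2 v))) * (gaussWeight v : ℂ)
      = ∑ i, ∑ j, Y i j * (star (tensorPow m (WithLp.toLp 2 v) i)
        * tensorPow m (WithLp.toLp 2 v) j * (gaussWeight v : ℂ)) := by
    intro v
    simp only [dotProduct, Matrix.mulVec, Finset.mul_sum, Finset.sum_mul, Pi.star_apply]
    exact Finset.sum_congr rfl fun i _ => Finset.sum_congr rfl fun j _ => by ring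
  have hint : ∀ i j : Idx d m, Integrable fun v : Fin d → ℂ =>
      Y i j * (star (tensorPow m (WithLp.toLp 2 v) i)
        * tensorPow m (WithLp.toLp 2 v) j * (gaussWeight v : ℂ)) :=
    fun i j => (integrable_star_tensorPow_mul_tensorPow i j).const_mul _
  have hI : Integrable fun v : Fin d → ℂ => (star (tensorPow m (WithLp.toLp 2 v)) ⬝ᵥ
      Y.mulVec (tensorPow m (WithLp.toLp 2 v))) * (gaussWeight v : ℂ) := by
    simp only [hexp]
    exact integrable_finsetSum _ fun i _ => integrable_finsetSum _ fun j _ => hint i j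
  have hval : ∫ v : Fin d → ℂ, (star (tensorPow m (WithLp.toLp 2 v)) ⬝ᵥ
      Y.mulVec (tensorPow m (WithLp.toLp 2 v))) * (gaussWeight v : ℂ)
      = ((Real.pi ^ d * m.factorial : ℝ) : ℂ) * (Y * symProj d m).trace := by
    simp only [hexp]
    rw [integral_finsetSum _ fun i _ => integrable_finsetSum _ fun j _ => hint i j]
    simp only [Matrix.trace, Matrix.diag, Matrix.mul_apply, Finset.mul_sum]
    refine Finset.sum_congr rfl fun i _ => ?_
    rw [integral_finsetSum _ fun j _ => hint i j]
    refine Finset.sum_congr rfl fun j _ => ?_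
    rw [integral_const_mul, integral_star_tensorPow_mul_tensorPow]
    push_cast
    ring
  have hnn : 0 ≤ ∫ v : Fin d → ℂ, ((star (tensorPow m (WithLp.toLp 2 v)) ⬝ᵥ
      Y.mulVec (tensorPow m (WithLp.toLp 2 v))) * (gaussWeight v : ℂ)).re :=
    integral_nonneg fun v => by
      rw [Complex.re_mul_ofReal]
      exact mul_nonneg (hY _) (Finset.prod_nonneg fun a _ => (Real.exp_pos _).le)
  have hre := integral_re hI
  simp only [RCLike.re_to_complex] at hre
  rw [hre, hval, Complex.re_ofReal_mul] at hnn
  exact nonneg_of_mul_nonneg_right hnn (by positivity)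

/-! ### The optimal cloning bound -/

theorem symState_isState (hd : 0 < d) : IsState (symState d n) := by
  have hD : (symDim d n : ℂ) ≠ 0 := by exact_mod_cast (symDim_pos hd).ne'
  refine ⟨?_, by rw [symState, Matrix.trace_smul, trace_symProj, smul_eq_mul, inv_mul_cancel₀ hD]⟩
  have : ((symDim d n : ℂ))⁻¹ = (((symDim d n : ℝ)⁻¹ : ℝ) : ℂ) := by push_cast; rfl
  rw [symState, this]
  exact symProj_posSemidef.smul (Complex.zero_le_real.2 (by positivity))

theorem symState_isSymSupported : IsSymSupported (symState d n) := by
  rw [IsSymSupported, symState, Matrix.mul_smul, Matrix.smul_mul, symProj_mul_self,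
    symProj_mul_self]

theorem CloningOracle.worstCaseFidelity_le_fidelity (C : CloningOracle d n m) (ψ : PureState d) :
    C.worstCaseFidelity ≤ fidelity (C.R (projPow n ψ.1)) (projPow m ψ.1) :=
  ciInf_le ⟨0, by rintro _ ⟨φ, rfl⟩; exact sq_nonneg _⟩ ψ

theorem exists_smul_unit_eq (hd : 0 < d) (ψ : EuclideanSpace ℂ (Fin d)) :
    ∃ u : PureState d, ψ = (‖ψ‖ : ℂ) • u.1 := by
  rcases eq_or_ne ψ 0 with rfl | h
  · exact ⟨⟨EuclideanSpace.single ⟨0, hd⟩ 1, by simp⟩, by simp⟩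
  · have h' : (‖ψ‖ : ℂ) ≠ 0 := by exact_mod_cast norm_ne_zero_iff.2 h
    refine ⟨⟨(‖ψ‖ : ℂ)⁻¹ • ψ, ?_⟩, (smul_inv_smul₀ h' ψ).symm⟩
    rw [norm_smul, norm_inv, Complex.norm_real, norm_norm,
      inv_mul_cancel₀ (norm_ne_zero_iff.2 h)]

/-- Since `|ψ⟩⟨ψ|^{⊗n} ≤ d[n] ρ_0^n`, the output on `ρ_0^n` has overlap at least `F_wc / d[n]` with
every `|ψ⟩^{⊗m}`, although it does not depend on `ψ`. -/
theorem CloningOracle.NoSignalling.worstCaseFidelity_le_expectation {C : CloningOracle d n m}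
    (hC : C.NoSignalling) (hd : 0 < d) (u : PureState d) :
    C.worstCaseFidelity ≤ symDim d n *
      (star (tensorPow m u.1) ⬝ᵥ (C.R (symState d n)).mulVec (tensorPow m u.1)).re := by
  have hD : 0 < (symDim d n : ℝ) := by exact_mod_cast symDim_pos hd
  have hu : ((((symDim d n : ℝ)⁻¹ : ℝ) : ℂ)) • projPow n u.1 ≤ symState d n := by
    rw [symState, Matrix.le_iff, Complex.ofReal_inv, Complex.ofReal_natCast, ← smul_sub,
      ← Complex.ofReal_natCast, ← Complex.ofReal_inv]
    exact (Matrix.le_iff.1 (projPow_le_symProj u.2)).smul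
      (Complex.zero_le_real.2 (inv_nonneg.2 hD.le))
  have hle := Matrix.le_iff.1 (hC.smul_R_le (symState_isState hd) (projPow_isState u.2)
    symState_isSymSupported (projPow_isSymSupported u.1) (inv_pos.2 hD) hu)
  have h0 := (Complex.le_def.1 (hle.dotProduct_mulVec_nonneg (tensorPow m u.1))).1
  rw [Matrix.sub_mulVec, Matrix.smul_mulVec, dotProduct_sub, dotProduct_smul, smul_eq_mul,
    Complex.sub_re, Complex.re_ofReal_mul, Complex.zero_re, sub_nonneg, inv_mul_le_iff₀ hD] at h0
  refine (C.worstCaseFidelity_le_fidelity u).trans ?_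
  rwa [fidelity_projPow
    (C.R_isState _ (projPow_isState u.2) (projPow_isSymSupported u.1)).1 u.2]

theorem CloningOracle.NoSignalling.worstCaseFidelity_mul_symDim_le {C : CloningOracle d n m}
    (hC : C.NoSignalling) (hd : 0 < d) : C.worstCaseFidelity * symDim d m ≤ symDim d n := by
  have hX := C.R_isState _ (symState_isState (n := n) hd) symState_isSymSupported
  set X := C.R (symState d n)
  -- The pointwise bound, homogenised to vectors of arbitrary norm, says that `d[n] X - F_wc` has
  -- nonnegative expectation on every `|ψ⟩^{⊗m}`.
  have hpos := trace_mul_symProj_nonneg (m := m)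
    (Y := ((symDim d n : ℝ) : ℂ) • X - (C.worstCaseFidelity : ℂ) • 1) fun ψ => by
      obtain ⟨u, hu⟩ := exists_smul_unit_eq hd ψ
      have huψ := hC.worstCaseFidelity_le_expectation hd u
      have hn : star (tensorPow m u.1) ⬝ᵥ tensorPow m u.1 = 1 := by
        rw [star_tensorPow_dotProduct, u.2]
        simp
      have hc : star ((‖ψ‖ : ℂ) ^ m) * (‖ψ‖ : ℂ) ^ m = ((‖ψ‖ ^ m * ‖ψ‖ ^ m : ℝ) : ℂ) := by
        rw [← Complex.ofReal_pow, ← starRingEnd_apply, Complex.conj_ofReal, Complex.ofReal_mul]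
      rw [hu, tensorPow_smul, star_smul, Matrix.mulVec_smul, smul_dotProduct, dotProduct_smul,
        smul_smul, hc, smul_eq_mul, Complex.re_ofReal_mul, Matrix.sub_mulVec, Matrix.smul_mulVec,
        Matrix.smul_mulVec, Matrix.one_mulVec, dotProduct_sub, dotProduct_smul, dotProduct_smul,
        hn, smul_eq_mul, smul_eq_mul, mul_one, Complex.sub_re, Complex.re_ofReal_mul,
        Complex.ofReal_re]
      exact mul_nonneg (mul_self_nonneg _) (sub_nonneg.2 huψ)
  rw [sub_mul, Matrix.smul_mul, Matrix.smul_mul, one_mul, Matrix.trace_sub, Matrix.trace_smul,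
    Matrix.trace_smul, trace_symProj, smul_eq_mul, smul_eq_mul, Complex.sub_re,
    Complex.re_ofReal_mul, Complex.re_ofReal_mul, Complex.natCast_re, sub_nonneg] at hpos
  have hXP := trace_mul_symProj_le hX.1
  rw [hX.2, Complex.one_re] at hXP
  calc _ ≤ _ := hpos
    _ ≤ (symDim d n : ℝ) * 1 := by gcongr
    _ = _ := mul_one _

/-! ### Designs and asymptotics -/

theorem IsWeightedApproxDesign.pos_dim {ε : ℝ} {W : Finset (PureState d)} {w : PureState d → ℝ}
    (h : IsWeightedApproxDesign n ε W w) : 0 < d := by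
  rcases Nat.eq_zero_or_pos d with rfl | hd
  · have : IsEmpty (PureState 0) := ⟨fun ψ => by simpa [Subsingleton.elim ψ.1 0] using ψ.2⟩
    simpa [Finset.eq_empty_of_isEmpty W] using h.sum_eq_one
  · exact hd

/-- The upper Loewner bound forces every weight to be at most `(1 + ε) / d[n]`, so a design has
at least `d[n] / (1 + ε)` elements. -/
theorem IsWeightedApproxDesign.symDim_le {ε : ℝ} {W : Finset (PureState d)} {w : PureState d → ℝ}
    (h : IsWeightedApproxDesign n ε W w) : (symDim d n : ℝ) ≤ (1 + ε) * W.card := by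
  have hD : 0 < (symDim d n : ℝ) := by exact_mod_cast symDim_pos h.pos_dim
  have hw : ∀ φ ∈ W, w φ ≤ (1 + ε) / symDim d n := by
    intro φ hφ
    have hle : (w φ : ℂ) • projPow n φ.1 ≤ ((1 + ε : ℝ) : ℂ) • symState d n :=
      (Finset.single_le_sum (f := fun φ : PureState d => (w φ : ℂ) • projPow n φ.1)
        (fun χ hχ => ((projPow_isState χ.2).1.smul
          (Complex.zero_le_real.2 (h.nonneg χ hχ))).nonneg) hφ).trans h.upper
    have h0 := (Complex.le_def.1
      ((Matrix.le_iff.1 hle).dotProduct_mulVec_nonneg (tensorPow n φ.1))).1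
    have hn : star (tensorPow n φ.1) ⬝ᵥ tensorPow n φ.1 = 1 := by
      rw [star_tensorPow_dotProduct, φ.2]
      simp
    have hp : (projPow n φ.1).mulVec (tensorPow n φ.1) = tensorPow n φ.1 := by
      rw [projPow, Matrix.vecMulVec_mulVec, hn]
      simp
    have hs : (symState d n).mulVec (tensorPow n φ.1)
        = (((symDim d n : ℝ)⁻¹ : ℝ) : ℂ) • tensorPow n φ.1 := by
      rw [symState, Matrix.smul_mulVec, symProj_mulVec_tensorPow]
      push_cast
      rfl
    rw [Matrix.sub_mulVec, Matrix.smul_mulVec, Matrix.smul_mulVec, hp, hs, dotProduct_sub,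
      dotProduct_smul, dotProduct_smul, dotProduct_smul, hn, smul_eq_mul, smul_eq_mul, smul_eq_mul,
      mul_one, mul_one, ← Complex.ofReal_mul, Complex.sub_re, Complex.ofReal_re, Complex.ofReal_re,
      Complex.zero_re, sub_nonneg] at h0
    exact h0
  have hsum := Finset.sum_le_sum hw
  rw [h.sum_eq_one, Finset.sum_const, nsmul_eq_mul, ← mul_div_assoc, le_div_iff₀ hD, one_mul]
    at hsum
  linarith

theorem symDim_le_pow (d n : ℕ) : symDim d n ≤ d ^ n := by
  rcases Nat.eq_zero_or_pos n with rfl | hn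
  · simp [symDim]
  · refine (Nat.choose_le_sub_pow _ _).trans (Nat.pow_le_pow_left ?_ n)
    omega

theorem pow_le_factorial_mul_symDim {d : ℕ} (hd : 0 < d) (m : ℕ) :
    (d : ℝ) ^ m ≤ m.factorial * symDim d m := by
  have h := Nat.pow_le_choose (α := ℝ) m (d + m - 1)
  rw [show d + m - 1 + 1 - m = d by omega] at h
  rw [div_le_iff₀ (by positivity), mul_comm] at h
  exact h

end NoCloning

theorem mainTheorem3 (n m : ℕ) :
    (∀ (d : ℕ) (ε : ℝ) (W : Finset (NoCloning.PureState d)) (w : NoCloning.PureState d → ℝ),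
      0 ≤ ε → ε < 1 → NoCloning.IsWeightedApproxDesign n ε W w →
      ∀ C : NoCloning.CloningOracle d n m, C.NoSignalling →
        C.worstCaseFidelity ≤
          (1 + ε) ^ 2 * (W.card : ℝ) / ((1 - ε) ^ 2 * (NoCloning.symDim d m : ℝ))) ∧
    (∃ (K : ℝ) (k : ℕ), ∀ d : ℕ, 2 ≤ d →
      ∀ C : NoCloning.CloningOracle d n m, C.NoSignalling →
        C.worstCaseFidelity ≤ K * (d : ℝ) ^ ((n : ℤ) - (m : ℤ)) * Real.log d ^ k) := by
  -- In the second part `K = m!` suffices and no logarithm is needed: `d[n] ≤ d ^ n` and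
  -- `d ^ m ≤ m! d[m]`.
  refine ⟨fun d ε W w hε hε1 hW C hC => ?_, m.factorial, 0, fun d hd C hC => ?_⟩
  · have hm : 0 < (NoCloning.symDim d m : ℝ) := by
      exact_mod_cast NoCloning.symDim_pos hW.pos_dim
    have h1 := hC.worstCaseFidelity_mul_symDim_le hW.pos_dim
    have hε' : 0 < 1 - ε := by linarith
    rw [← div_div, le_div_iff₀ hm]
    refine (h1.trans hW.symDim_le).trans ?_
    rw [le_div_iff₀ (by positivity)]
    have h2 : (1 - ε) ^ 2 ≤ 1 := by nlinarith
    calc (1 + ε) * W.card * (1 - ε) ^ 2 ≤ (1 + ε) * W.card * 1 := by gcongr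
      _ ≤ (1 + ε) * W.card * (1 + ε) := by gcongr; linarith
      _ = (1 + ε) ^ 2 * W.card := by ring
  · have hd0 : 0 < d := by omega
    have hdR : (0 : ℝ) < d := by exact_mod_cast hd0
    have hm : 0 < (NoCloning.symDim d m : ℝ) := by exact_mod_cast NoCloning.symDim_pos hd0
    have hn : (NoCloning.symDim d n : ℝ) ≤ (d : ℝ) ^ n := by
      exact_mod_cast NoCloning.symDim_le_pow d n
    have h1 := (le_div_iff₀ hm).2 (hC.worstCaseFidelity_mul_symDim_le hd0)
    rw [pow_zero, mul_one, zpow_sub₀ hdR.ne', zpow_natCast, zpow_natCast, ← mul_div_assoc]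
    refine h1.trans ?_
    rw [div_le_div_iff₀ hm (by positivity)]
    calc (NoCloning.symDim d n : ℝ) * (d : ℝ) ^ m
        ≤ (d : ℝ) ^ n * (m.factorial * NoCloning.symDim d m) := by
          gcongr
          exact NoCloning.pow_le_factorial_mul_symDim hd0 m
      _ = m.factorial * (d : ℝ) ^ n * NoCloning.symDim d m := by ring
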